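/- Let $A$ be the $C^*$-subalgebra of $\ell^\infty(\mathbb N)$ (complex-valued sequences) consisting of all bounded sequences $(a_n)$ with $\lim_{n\to\infty}|a_{n+1}-a_n|=0$, and let $\nu\mathbb N$ be its Gelfand spectrum (the Higson compactification of $\mathbb N$); for $n\in\mathbb N$ write $\mathrm{ev}_n\in\nu\mathbb N$ for the character $a\mapsto a_n$. For a commutative unital $C^*$-algebra $B$, let $l_2(B)$ be the standard Hilbert $B$-module of all sequences $(b_i)$ in $B$ such that $\sum_i b_i^*b_i$ converges in norm, with $\|(b_i)\|^2=\|\sum_i b_i^*b_i\|$. For a Hilbert $B$-module $M$, let $M'$ be the normed $B$-module of bounded $B$-linear maps $M\to B$ with the operator norm, and let $M''=(M')'$. The module $M$ is called $C^*$-reflexive if the canonical map $M\to M''$, $m\mapsto(f\mapsto f(m))$, is bijective, and the $C^*$-algebra $B$ is called $C^*$-reflexive if $l_2(B)$ is. Theorem. 1. The map $n\mapsto \mathrm{ev}_n$ is an open embedding of the discrete space $\mathbb N$ in $\nu\mathbb N$ with dense image, and $h\mapsto (h(\mathrm{ev}_n))_n$ is a $*$-isomorphism from $C(\nu\mathbb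 N)$ onto $A$. 2. The $C^*$-algebra $A=C(\nu\mathbb N)$ is $C^*$-reflexive. 3. For every strictly increasing sequence $(n_k)$ in $\mathbb N$ with $n_{k+1}-n_k\to\infty$, the map $k\mapsto \mathrm{ev}_{n_k}$ extends to a closed embedding $\beta\mathbb N\to\nu\mathbb N$ of the Stone–Čech compactification of $\mathbb N$. In particular $\nu\mathbb N$ contains a copy of $\beta\mathbb N$ as a closed subset. 4. Consequently, for compact Hausdorff $X$, the condition that $X$ contains no copy of $\beta\mathbb N$ as a closed subset is not necessary for $C(X)$ to be $C^*$-reflexive: it is not true that, for every compact Hausdorff space $X$, if $C(X)$ is $C^*$-reflexive then $X$ contains no closed copy of $\beta\mathbb N$. -/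

import Mathlib

open Filter Topology

/-! ### Dual modules and `C⋆`-reflexivity over a commutative unital `C⋆`-algebra -/

section Dual

variable (A : Type*) [CommCStarAlgebra A]

section

variable (E : Type*) [NormedAddCommGroup E] [Module A E]

/-- The dual module `E'`: all bounded `A`-linear maps `E → A`. -/
def HilbertDual : Submodule A (E →ₗ[A] A) where
  carrier := {f | ∃ C : ℝ, ∀ x, ‖f x‖ ≤ C * ‖x‖}
  zero_mem' := ⟨0, fun x => by simp⟩
  add_mem' := by
    rintro f g ⟨C, hC⟩ ⟨D, hD⟩
    refine ⟨C + D, fun x => ?_⟩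
    calc ‖(f + g) x‖ ≤ ‖f x‖ + ‖g x‖ := norm_add_le _ _
      _ ≤ C * ‖x‖ + D * ‖x‖ := add_le_add (hC x) (hD x)
      _ = (C + D) * ‖x‖ := by ring
  smul_mem' := by
    rintro a f ⟨C, hC⟩
    refine ⟨‖a‖ * C, fun x => ?_⟩
    calc ‖(a • f) x‖ ≤ ‖a‖ * ‖f x‖ := norm_mul_le _ _
      _ ≤ ‖a‖ * (C * ‖x‖) := mul_le_mul_of_nonneg_left (hC x) (norm_nonneg _)
      _ = ‖a‖ * C * ‖x‖ := by ring

end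

variable {A} {E : Type*} [NormedAddCommGroup E] [Module A E]

namespace HilbertDual

/-- The operator norm of a functional. -/
noncomputable instance : Norm (HilbertDual A E) where
  norm f := sInf {C : ℝ | 0 ≤ C ∧ ∀ x, ‖f.1 x‖ ≤ C * ‖x‖}

theorem norm_def (f : HilbertDual A E) :
    ‖f‖ = sInf {C : ℝ | 0 ≤ C ∧ ∀ x, ‖f.1 x‖ ≤ C * ‖x‖} := rfl

theorem norm_le_of_bound {f : HilbertDual A E} {C : ℝ} (h0 : 0 ≤ C)
    (h : ∀ x, ‖f.1 x‖ ≤ C * ‖x‖) : ‖f‖ ≤ C :=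
  csInf_le ⟨0, fun _ h => h.1⟩ ⟨h0, h⟩

theorem norm_nonneg' (f : HilbertDual A E) : 0 ≤ ‖f‖ :=
  Real.sInf_nonneg fun _ h => h.1

theorem le_norm (f : HilbertDual A E) (x : E) : ‖f.1 x‖ ≤ ‖f‖ * ‖x‖ := by
  obtain ⟨C, hC⟩ := f.2
  have hne : {C : ℝ | 0 ≤ C ∧ ∀ x, ‖f.1 x‖ ≤ C * ‖x‖}.Nonempty :=
    ⟨|C|, abs_nonneg C, fun y =>
      (hC y).trans (mul_le_mul_of_nonneg_right (le_abs_self C) (norm_nonneg y))⟩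
  rcases (norm_nonneg x).eq_or_lt with hx | hx
  · have := hC x
    rw [← hx] at this ⊢
    simpa using this
  · rw [← div_le_iff₀ hx]
    exact le_csInf hne fun D hD => (div_le_iff₀ hx).2 (hD.2 x)

noncomputable instance : NormedAddCommGroup (HilbertDual A E) :=
  AddGroupNorm.toNormedAddCommGroup
    { toFun := fun f => ‖f‖
      map_zero' := le_antisymm (norm_le_of_bound le_rfl fun x => by simp) (norm_nonneg' _)
      add_le' := fun f g => norm_le_of_bound (add_nonneg (norm_nonneg' f) (norm_nonneg' g))
        fun x => by
          calc ‖(f + g).1 x‖ ≤ ‖f.1 x‖ + ‖g.1 x‖ := norm_add_le _ _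
            _ ≤ ‖f‖ * ‖x‖ + ‖g‖ * ‖x‖ := add_le_add (le_norm f x) (le_norm g x)
            _ = (‖f‖ + ‖g‖) * ‖x‖ := by ring
      neg' := fun f => by
        simp only [norm_def]
        congr 1
        ext C
        simp
      eq_zero_of_map_eq_zero' := fun f hf => by
        apply Subtype.ext
        ext x
        have h := le_norm f x
        rw [hf, zero_mul] at h
        simpa using h }

end HilbertDual

variable (A E)

/-- The canonical map `E → E''`, `m ↦ ṁ`, `ṁ f = f m`. -/
def hilbertBidualMap : E →ₗ[A] HilbertDual A (HilbertDual A E) where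
  toFun m :=
    ⟨{ toFun := fun f => f.1 m
       map_add' := fun _ _ => rfl
       map_smul' := fun _ _ => rfl },
     ‖m‖, fun f => by simpa [mul_comm] using HilbertDual.le_norm f m⟩
  map_add' m n := by
    apply Subtype.ext
    ext f
    exact map_add f.1 m n
  map_smul' a m := by
    apply Subtype.ext
    ext f
    exact map_smul f.1 a m

/-- A module `E` is `C⋆`-reflexive if `E'' = E` through the canonical map. -/
def IsCStarReflexiveModule : Prop :=
  Function.Bijective (hilbertBidualMap A E)

end Dual

/-! ### The standard Hilbert module `l₂(A)` -/

section StandardModule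

variable (A : Type*) [CommCStarAlgebra A]

theorem summable_of_nonneg_of_le_cstar {A : Type*} [CommCStarAlgebra A] [PartialOrder A]
    [StarOrderedRing A] {f g : ℕ → A} (h0 : ∀ i, 0 ≤ f i) (h : ∀ i, f i ≤ g i)
    (hg : Summable g) : Summable f := by
  rw [summable_iff_vanishing_norm] at hg ⊢
  intro ε hε
  obtain ⟨s, hs⟩ := hg ε hε
  exact ⟨s, fun t ht => (CStarAlgebra.norm_le_norm_of_nonneg_of_le
    (Finset.sum_nonneg fun i _ => h0 i) (Finset.sum_le_sum fun i _ => h i)).trans_lt (hs t ht)⟩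

theorem summable_star_mul_add {A : Type*} [CommCStarAlgebra A] {a b : ℕ → A}
    (ha : Summable fun i => star (a i) * a i) (hb : Summable fun i => star (b i) * b i) :
    Summable fun i => star (a i + b i) * (a i + b i) := by
  let _ : PartialOrder A := CStarAlgebra.spectralOrder A
  let _ : StarOrderedRing A := CStarAlgebra.spectralOrderedRing A
  refine summable_of_nonneg_of_le_cstar (fun i => star_mul_self_nonneg _) (fun i => ?_)
    ((ha.add hb).add (ha.add hb))
  have h := star_mul_self_nonneg (a i - b i)
  rw [← sub_nonneg]
  convert h using 1
  simp only [star_add, star_sub]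
  ring

/-- The sequences `(a₁, a₂, …)` in `A` for which `∑ aᵢ⋆ aᵢ` converges in norm. -/
def l2Submodule : Submodule A (ℕ → A) where
  carrier := {a | Summable fun i => star (a i) * a i}
  zero_mem' := by simp
  add_mem' := fun ha hb => summable_star_mul_add ha hb
  smul_mem' := by
    intro c a ha
    have h := Summable.mul_left (star c * c) ha
    refine h.congr fun i => ?_
    simp only [Pi.smul_apply, smul_eq_mul, star_mul']
    ring

/-- The standard Hilbert `A`-module `H_A = l₂(A)`. -/
def L2 : Type _ := l2Submodule A

namespace L2

noncomputable instance : AddCommGroup (L2 A) := inferInstanceAs (AddCommGroup (l2Submodule A))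
noncomputable instance : Module A (L2 A) := inferInstanceAs (Module A (l2Submodule A))
noncomputable instance : Module ℂ (L2 A) := inferInstanceAs (Module ℂ (l2Submodule A))

noncomputable instance : Inner A (L2 A) where
  inner x y := ∑' i, star (x.1 i) * y.1 i

/-- `‖a‖ = ‖⟨a, a⟩‖ ^ (1/2) = ‖∑ aᵢ⋆ aᵢ‖ ^ (1/2)`. -/
noncomputable instance : Norm (L2 A) where
  norm x := √‖inner A x x‖

variable {A}

theorem inner_def (x y : L2 A) : inner A x y = ∑' i, star (x.1 i) * y.1 i := rfl

theorem summable_inner (x y : L2 A) : Summable fun i => star (x.1 i) * y.1 i := by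
  have key : ∀ c : ℂ, Summable fun i => star (x.1 i + c • y.1 i) * (x.1 i + c • y.1 i) :=
    fun c => summable_star_mul_add x.2 ((c • y : L2 A).2)
  have h := ((((key 1).sub (key (-1))).sub ((key Complex.I).const_smul Complex.I)).add
    ((key (-Complex.I)).const_smul Complex.I)).const_smul (1 / 4 : ℂ)
  refine h.congr fun i => ?_
  simp only [star_add, star_smul, add_mul, mul_add, smul_mul_assoc, mul_smul_comm, smul_add,
    smul_sub, smul_smul, star_one, star_neg, RCLike.star_def, Complex.conj_I]
  match_scalars <;> ring_nf <;> norm_num [Complex.I_sq]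

noncomputable instance [PartialOrder A] [StarOrderedRing A] : CStarModule A (L2 A) where
  inner_add_right {x y z} := by
    simp only [inner_def]
    rw [← (summable_inner x y).tsum_add (summable_inner x z)]
    exact tsum_congr fun i => mul_add _ _ _
  inner_self_nonneg {x} := tsum_nonneg fun i => star_mul_self_nonneg _
  inner_self {x} := by
    constructor
    · intro h
      have h0 := (hasSum_zero_iff_of_nonneg fun i => star_mul_self_nonneg (x.1 i)).1
        ((summable_inner x x).hasSum_iff.2 h)
      apply Subtype.ext
      funext i
      exact (CStarRing.star_mul_self_eq_zero_iff _).1 (congrFun h0 i)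
    · rintro rfl
      rw [inner_def, ← tsum_zero (α := A) (β := ℕ)]
      exact tsum_congr fun i => mul_zero _
  inner_op_smul_right {a x y} := by
    simp only [inner_def]
    rw [← (summable_inner x y).tsum_mul_left]
    exact tsum_congr fun i => mul_left_comm _ _ _
  inner_smul_right_complex {z x y} := by
    simp only [inner_def]
    rw [← (summable_inner x y).tsum_const_smul]
    exact tsum_congr fun i => mul_smul_comm _ _ _
  star_inner x y := by
    simp only [inner_def]
    rw [tsum_star]
    exact tsum_congr fun i => by rw [star_mul, star_star]
  norm_eq_sqrt_norm_inner_self x := rfl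

theorem normedSpaceCore : NormedSpace.Core ℂ (L2 A) := by
  let _ : PartialOrder A := CStarAlgebra.spectralOrder A
  let _ : StarOrderedRing A := CStarAlgebra.spectralOrderedRing A
  exact CStarModule.normedSpaceCore A

noncomputable instance : NormedAddCommGroup (L2 A) :=
  NormedAddCommGroup.ofCore (𝕜 := ℂ) normedSpaceCore

end L2

/-- A `C⋆`-algebra `A` is `C⋆`-reflexive if the Hilbert module `l₂(A)` is. -/
def IsCStarReflexive : Prop := IsCStarReflexiveModule A (L2 A)

end StandardModule

/-! ### The Higson compactification of `ℕ` -/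

/-- The `C⋆`-subalgebra of `l^∞` of all bounded sequences with `|a (n + 1) - a n| → 0`. -/
noncomputable def higsonAlgebra : StarSubalgebra ℂ (BoundedContinuousFunction ℕ ℂ) where
  carrier := {a | Tendsto (fun n => ‖a (n + 1) - a n‖) atTop (𝓝 0)}
  zero_mem' := by simp
  one_mem' := by simp
  add_mem' := by
    intro a b ha hb
    refine squeeze_zero (fun _ => norm_nonneg _) (fun n => ?_) (by simpa using ha.add hb)
    have : (a + b) (n + 1) - (a + b) n = (a (n + 1) - a n) + (b (n + 1) - b n) := by
      simp only [BoundedContinuousFunction.coe_add, Pi.add_apply]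
      ring
    rw [this]
    exact norm_add_le _ _
  mul_mem' := by
    intro a b ha hb
    refine squeeze_zero (fun _ => norm_nonneg _) (fun n => ?_)
      (by simpa using (ha.const_mul ‖b‖).add (hb.const_mul ‖a‖))
    have : (a * b) (n + 1) - (a * b) n =
        b (n + 1) * (a (n + 1) - a n) + a n * (b (n + 1) - b n) := by
      simp only [BoundedContinuousFunction.coe_mul, Pi.mul_apply]
      ring
    rw [this]
    refine (norm_add_le _ _).trans ?_
    rw [norm_mul, norm_mul]
    exact add_le_add (mul_le_mul_of_nonneg_right (b.norm_coe_le_norm _) (norm_nonneg _))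
      (mul_le_mul_of_nonneg_right (a.norm_coe_le_norm _) (norm_nonneg _))
  algebraMap_mem' := by
    intro c
    simp
  star_mem' := by
    intro a ha
    refine ha.congr fun n => ?_
    rw [BoundedContinuousFunction.star_apply, BoundedContinuousFunction.star_apply, ← star_sub,
      norm_star]

theorem mem_higsonAlgebra {a : BoundedContinuousFunction ℕ ℂ} :
    a ∈ higsonAlgebra ↔ Tendsto (fun n => ‖a (n + 1) - a n‖) atTop (𝓝 0) := Iff.rfl

instance isClosed_higsonAlgebra :
    IsClosed (higsonAlgebra : Set (BoundedContinuousFunction ℕ ℂ)) := by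
  refine isClosed_of_closure_subset fun a ha => ?_
  show Tendsto (fun n => ‖a (n + 1) - a n‖) atTop (𝓝 0)
  rw [Metric.tendsto_atTop]
  intro ε hε
  obtain ⟨b, hb, hab⟩ := Metric.mem_closure_iff.1 ha (ε / 4) (by positivity)
  obtain ⟨N, hN⟩ := (Metric.tendsto_atTop.1 (mem_higsonAlgebra.1 hb)) (ε / 4) (by positivity)
  refine ⟨N, fun n hn => ?_⟩
  have h1 := hN n hn
  rw [Real.dist_eq, sub_zero, abs_norm] at h1 ⊢
  have h2 : ∀ m, ‖a m - b m‖ < ε / 4 := fun m => by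
    rw [← dist_eq_norm]
    exact (BoundedContinuousFunction.dist_coe_le_dist m).trans_lt hab
  have e : a (n + 1) - a n = (a (n + 1) - b (n + 1)) + (b (n + 1) - b n) - (a n - b n) := by ring
  rw [e]
  refine (norm_sub_le _ _).trans_lt ?_
  have := norm_add_le (a (n + 1) - b (n + 1)) (b (n + 1) - b n)
  linarith [h2 (n + 1), h2 n]

/-- The Higson compactification `νℕ`: the Gelfand spectrum of the algebra above. -/
abbrev HigsonCompactification : Type := WeakDual.characterSpace ℂ higsonAlgebra

/-- The point of `νℕ` given by `n : ℕ`, that is, the evaluation character `a ↦ a n`. -/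
noncomputable def higsonUnit (n : ℕ) : HigsonCompactification :=
  WeakDual.CharacterSpace.equivAlgHom.symm
    { toFun := fun a => a.1 n
      map_one' := rfl
      map_mul' := fun _ _ => rfl
      map_zero' := rfl
      map_add' := fun _ _ => rfl
      commutes' := fun _ => rfl }

theorem higsonUnit_apply (n : ℕ) (a : higsonAlgebra) : higsonUnit n a = a.1 n := rfl

/-! ### Coordinates of functionals on `l₂(A)` -/

namespace L2

variable {A : Type*} [CommCStarAlgebra A]

/-! A functional `f` on `l₂(A)` is given by its coefficients `f (e i)`: exactly those sequences
occur whose values are square summable at each evaluation, with a uniform bound. An element `F` of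
the bidual likewise yields `m i = F (coord i)` with uniformly bounded pointwise sums. Multiplying by
the indicator of an isolated point `n` localizes `F`, so `F f` at `n` is `∑ f (e i) n * m i n`
(`hasSum_character_bidual`). Thus `F` comes from `l₂(A)` once `∑ star (m i) * m i` converges in
norm.

If it does not, there are disjoint finite blocks of indices and points at mutual distance at least 2
such that each block has mass more than `ε / 2` at its point. The functional with coefficients `star
(m i)` at the point of the block of `i` and zero elsewhere is bounded, yet its image under `F` is at
least `ε / 2` in norm at the chosen points and zero at their successors. No slowly oscillating
sequence does this (`isCStarReflexive_of_oscillation`).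

Sparse sequences nevertheless carry copies of `βℕ`: linear interpolation across gaps tending to
infinity oscillates slowly, so all `[0, 1]`-valued data on the sequence extend
(`exists_slowly_oscillating_extension`). -/

theorem norm_sq_eq (x : L2 A) : ‖x‖ ^ 2 = ‖∑' i, star (x.1 i) * x.1 i‖ :=
  Real.sq_sqrt (norm_nonneg _)

theorem norm_sum_star_mul_self_le (x : L2 A) (s : Finset ℕ) :
    ‖∑ i ∈ s, star (x.1 i) * x.1 i‖ ≤ ‖x‖ ^ 2 := by
  let _ : PartialOrder A := CStarAlgebra.spectralOrder A
  let _ : StarOrderedRing A := CStarAlgebra.spectralOrderedRing A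
  rw [norm_sq_eq]
  exact CStarAlgebra.norm_le_norm_of_nonneg_of_le
    (Finset.sum_nonneg fun i _ => star_mul_self_nonneg _)
    ((show Summable fun i => star (x.1 i) * x.1 i from x.2).sum_le_tsum s
      fun i _ => star_mul_self_nonneg _)

/-- The sequence with entries `a i` for `i ∈ s` and zero elsewhere. -/
def ofFinset (s : Finset ℕ) (a : ℕ → A) : L2 A :=
  ⟨fun i => if i ∈ s then a i else 0, by
    refine summable_of_ne_finset_zero (s := s) fun i hi => ?_
    simp [hi]⟩

theorem ofFinset_apply (s : Finset ℕ) (a : ℕ → A) (i : ℕ) :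
    (ofFinset s a).1 i = if i ∈ s then a i else 0 := rfl

theorem norm_ofFinset_sq (s : Finset ℕ) (a : ℕ → A) :
    ‖ofFinset s a‖ ^ 2 = ‖∑ i ∈ s, star (a i) * a i‖ := by
  rw [norm_sq_eq, tsum_eq_sum (s := s) fun i hi => by simp [ofFinset_apply, hi]]
  congr 1
  exact Finset.sum_congr rfl fun i hi => by simp [ofFinset_apply, hi]

/-- The standard basis of `l₂(A)`. -/
noncomputable def basis (i : ℕ) : L2 A := ofFinset {i} 1

theorem basis_apply (i j : ℕ) : (basis i : L2 A).1 j = if j = i then 1 else 0 := by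
  simp [basis, ofFinset_apply]

theorem add_apply (x y : L2 A) (i : ℕ) : (x + y).1 i = x.1 i + y.1 i := rfl

theorem sub_apply (x y : L2 A) (i : ℕ) : (x - y).1 i = x.1 i - y.1 i := rfl

theorem smul_apply (a : A) (x : L2 A) (i : ℕ) : (a • x).1 i = a * x.1 i := rfl

theorem ofFinset_eq_sum (s : Finset ℕ) (a : ℕ → A) :
    ofFinset s a = ∑ i ∈ s, a i • (basis i : L2 A) := by
  have h : ∀ (t : Finset ℕ) (g : ℕ → L2 A) (j : ℕ), (∑ i ∈ t, g i).1 j = ∑ i ∈ t, (g i).1 j := by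
    intro t g j
    induction t using Finset.cons_induction with
    | empty => rfl
    | cons i t hi ih => rw [Finset.sum_cons, Finset.sum_cons, add_apply, ih]
  apply Subtype.ext
  funext j
  rw [h, ofFinset_apply]
  simp [smul_apply, basis_apply]

theorem tendsto_norm_sub_ofFinset (x : L2 A) :
    Tendsto (fun s : Finset ℕ => ‖x - ofFinset s x.1‖) atTop (𝓝 0) := by
  have hx : Summable fun i => star (x.1 i) * x.1 i := x.2
  have h : Tendsto (fun s : Finset ℕ => ‖x - ofFinset s x.1‖ ^ 2) atTop (𝓝 0) := by
    have h0 := (tendsto_const_nhds (x := ∑' i, star (x.1 i) * x.1 i)).sub hx.hasSum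
    rw [sub_self] at h0
    refine (tendsto_norm_zero.comp h0).congr fun s => ?_
    rw [norm_sq_eq, Function.comp_apply]
    congr 1
    have h1 := hx.hasSum.sub (hasSum_sum_of_ne_finset_zero (s := s)
      (f := fun i => if i ∈ s then star (x.1 i) * x.1 i else 0) fun i hi => by simp [hi])
    rw [Finset.sum_congr rfl fun i hi => if_pos hi] at h1
    rw [← h1.tsum_eq]
    refine tsum_congr fun i => ?_
    by_cases hi : i ∈ s <;> simp [sub_apply, ofFinset_apply, hi]
  have h2 := h.sqrt
  simpa [Real.sqrt_sq (norm_nonneg _)] using h2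

end L2

namespace HilbertDual

variable {A : Type*} [CommCStarAlgebra A]

theorem sum_val {E : Type*} [NormedAddCommGroup E] [Module A E] (s : Finset ℕ)
    (g : ℕ → HilbertDual A E) (x : E) : (∑ i ∈ s, g i).1 x = ∑ i ∈ s, (g i).1 x := by
  rw [AddSubmonoidClass.coe_finsetSum, LinearMap.sum_apply]

/-- Truncations of `x` converge to `x` in norm, and `f` is bounded. -/
theorem hasSum_apply (f : HilbertDual A (L2 A)) (x : L2 A) :
    HasSum (fun i => f.1 (L2.basis i) * x.1 i) (f.1 x) := by
  rw [HasSum, SummationFilter.unconditional_filter, tendsto_iff_norm_sub_tendsto_zero]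
  refine squeeze_zero (fun _ => norm_nonneg _) (fun s => ?_)
    (by simpa using (L2.tendsto_norm_sub_ofFinset x).const_mul ‖f‖)
  rw [norm_sub_rev]
  refine le_trans (le_of_eq ?_) (le_norm f _)
  rw [map_sub, L2.ofFinset_eq_sum, map_sum]
  simp only [map_smul, smul_eq_mul, mul_comm]

/-- The coordinate functionals on `l₂(A)`. -/
def coord (i : ℕ) : HilbertDual A (L2 A) :=
  ⟨{ toFun := fun x => x.1 i
     map_add' := fun _ _ => rfl
     map_smul' := fun _ _ => rfl },
   1, fun x => by
    have h := L2.norm_sum_star_mul_self_le x {i}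
    rw [Finset.sum_singleton, CStarRing.norm_star_mul_self, ← sq] at h
    rw [one_mul]
    exact le_of_sq_le_sq h (norm_nonneg _)⟩

end HilbertDual

/-! ### Algebras normed by a family of characters -/

/-- A family of characters that determines the norm of `A`. -/
def IsNormingFamily {A T : Type*} [CommCStarAlgebra A] (ev : T → A →⋆ₐ[ℂ] ℂ) : Prop :=
  ∀ (a : A) (C : ℝ), 0 ≤ C → (∀ t, ‖ev t a‖ ≤ C) → ‖a‖ ≤ C

section Characters

variable {A T : Type*} [CommCStarAlgebra A] {ev : T → A →⋆ₐ[ℂ] ℂ}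

theorem norm_character_le (φ : A →⋆ₐ[ℂ] ℂ) (a : A) : ‖φ a‖ ≤ ‖a‖ :=
  NonUnitalStarAlgHom.norm_apply_le φ a

theorem character_sum_star_mul_self (φ : A →⋆ₐ[ℂ] ℂ) (s : Finset ℕ) (x : ℕ → A) :
    φ (∑ i ∈ s, star (x i) * x i) = ((∑ i ∈ s, ‖φ (x i)‖ ^ 2 : ℝ) : ℂ) := by
  rw [map_sum, Complex.ofReal_sum]
  refine Finset.sum_congr rfl fun i _ => ?_
  rw [map_mul, map_star, RCLike.star_def, RCLike.conj_mul]
  norm_cast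

theorem sum_norm_character_sq_le (φ : A →⋆ₐ[ℂ] ℂ) (s : Finset ℕ) (x : ℕ → A) :
    ∑ i ∈ s, ‖φ (x i)‖ ^ 2 ≤ ‖∑ i ∈ s, star (x i) * x i‖ := by
  have h := norm_character_le φ (∑ i ∈ s, star (x i) * x i)
  rw [character_sum_star_mul_self, Complex.norm_real, Real.norm_of_nonneg
    (Finset.sum_nonneg fun _ _ => sq_nonneg _)] at h
  exact h

theorem IsNormingFamily.ext (hev : IsNormingFamily ev) {a b : A} (h : ∀ t, ev t a = ev t b) :
    a = b := by
  rw [← sub_eq_zero, ← norm_le_zero_iff]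
  exact hev _ 0 le_rfl fun t => by simp [h t]

/-- Scalar Cauchy–Schwarz under each character. Only pointwise control of `c` is needed. -/
theorem IsNormingFamily.norm_sum_mul_le (hev : IsNormingFamily ev) {s : Finset ℕ} {c : ℕ → A}
    (x : ℕ → A) {C : ℝ} (hC : 0 ≤ C) (hc : ∀ t, ∑ i ∈ s, ‖ev t (c i)‖ ^ 2 ≤ C ^ 2) :
    ‖∑ i ∈ s, c i * x i‖ ≤ C * √‖∑ i ∈ s, star (x i) * x i‖ := by
  refine hev _ _ (by positivity) fun t => ?_
  calc ‖ev t (∑ i ∈ s, c i * x i)‖ ≤ ∑ i ∈ s, ‖ev t (c i)‖ * ‖ev t (x i)‖ := by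
        rw [map_sum]
        refine (norm_sum_le _ _).trans_eq (Finset.sum_congr rfl fun i _ => ?_)
        rw [map_mul, norm_mul]
    _ ≤ √(∑ i ∈ s, ‖ev t (c i)‖ ^ 2) * √(∑ i ∈ s, ‖ev t (x i)‖ ^ 2) :=
        Real.sum_mul_le_sqrt_mul_sqrt _ _ _
    _ ≤ C * √‖∑ i ∈ s, star (x i) * x i‖ := by
        gcongr
        · exact (Real.sqrt_le_sqrt (hc t)).trans_eq (Real.sqrt_sq hC)
        · exact sum_norm_character_sq_le _ _ _

end Characters

/-! ### The dual and the bidual of `l₂(A)` in terms of coordinates -/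

namespace HilbertDual

variable {A T : Type*} [CommCStarAlgebra A] {ev : T → A →⋆ₐ[ℂ] ℂ}

theorem norm_le_of_sum_sq_le (hev : IsNormingFamily ev) {f : HilbertDual A (L2 A)} {C : ℝ}
    (hC : 0 ≤ C) (h : ∀ t (s : Finset ℕ), ∑ i ∈ s, ‖ev t (f.1 (L2.basis i))‖ ^ 2 ≤ C ^ 2) :
    ‖f‖ ≤ C := by
  refine norm_le_of_bound hC fun x => le_of_tendsto (hasSum_apply f x).norm <|
    Eventually.of_forall fun s => (hev.norm_sum_mul_le x.1 hC (h · s)).trans ?_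
  gcongr
  exact (Real.sqrt_le_sqrt (L2.norm_sum_star_mul_self_le x s)).trans_eq
    (Real.sqrt_sq (norm_nonneg _))

/-- The series for `x` supplies the Cauchy condition, so `∑ star (c i) * c i` need not converge in
norm. This is what makes the dual larger than `l₂(A)` in general. -/
theorem exists_apply_basis_eq (hev : IsNormingFamily ev) {c : ℕ → A} {C : ℝ} (hC : 0 ≤ C)
    (h : ∀ t (s : Finset ℕ), ∑ i ∈ s, ‖ev t (c i)‖ ^ 2 ≤ C ^ 2) :
    ∃ f : HilbertDual A (L2 A), ∀ i, f.1 (L2.basis i) = c i := by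
  have hsum : ∀ x : L2 A, Summable fun i => c i * x.1 i := by
    intro x
    have hx : Summable fun i => star (x.1 i) * x.1 i := x.2
    rw [summable_iff_vanishing_norm] at hx ⊢
    intro ε hε
    -- `C + 1` rather than `C`, since `C` may be zero.
    obtain ⟨s, hs⟩ := hx ((ε / (C + 1)) ^ 2) (by positivity)
    refine ⟨s, fun t ht => (hev.norm_sum_mul_le x.1 hC (h · t)).trans_lt ?_⟩
    have h1 : √‖∑ i ∈ t, star (x.1 i) * x.1 i‖ < ε / (C + 1) := by
      rw [Real.sqrt_lt' (by positivity)]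
      exact hs t ht
    calc C * √‖∑ i ∈ t, star (x.1 i) * x.1 i‖
        ≤ (C + 1) * √‖∑ i ∈ t, star (x.1 i) * x.1 i‖ := by gcongr; linarith
      _ < (C + 1) * (ε / (C + 1)) := by gcongr
      _ = ε := by field_simp
  refine ⟨⟨{ toFun := fun x => ∑' i, c i * x.1 i
             map_add' := fun x y => ?_
             map_smul' := fun a x => ?_ }, C, fun x => ?_⟩, fun i => ?_⟩
  · rw [← (hsum x).tsum_add (hsum y)]
    exact tsum_congr fun i => mul_add _ _ _
  · rw [RingHom.id_apply, smul_eq_mul, ← (hsum x).tsum_mul_left]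
    exact tsum_congr fun i => mul_left_comm _ _ _
  · refine le_of_tendsto (hsum x).hasSum.norm <| Eventually.of_forall fun s =>
      (hev.norm_sum_mul_le x.1 hC (h · s)).trans ?_
    gcongr
    exact (Real.sqrt_le_sqrt (L2.norm_sum_star_mul_self_le x s)).trans_eq
      (Real.sqrt_sq (norm_nonneg _))
  · show ∑' j, c j * (L2.basis i : L2 A).1 j = c i
    rw [tsum_eq_single i fun j hj => by simp [L2.basis_apply, hj]]
    simp [L2.basis_apply]

theorem le_sq_of_le_mul_sqrt {S C : ℝ} (hS : 0 ≤ S) (h : S ≤ C * √S) : S ≤ C ^ 2 := by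
  have h1 := Real.sq_sqrt hS
  have h2 := Real.sqrt_nonneg S
  rcases h2.eq_or_lt with h3 | h3
  · rw [← h3, mul_zero] at h
    exact h.trans (sq_nonneg C)
  · have h4 : √S ≤ C := by
      refine le_of_mul_le_mul_right ?_ h3
      rwa [← sq, h1]
    exact h1.symm.le.trans (pow_le_pow_left₀ h2 h4 2)

theorem character_algebraMap_star_mul (φ : A →⋆ₐ[ℂ] ℂ) (a : A) :
    φ (algebraMap ℂ A (star (φ a)) * a) = ((‖φ a‖ ^ 2 : ℝ) : ℂ) := by
  rw [map_mul, AlgHomClass.commutes, Algebra.algebraMap_self, RingHom.id_apply, RCLike.star_def,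
    RCLike.conj_mul]
  norm_cast

theorem norm_character_algebraMap (φ : A →⋆ₐ[ℂ] ℂ) (z : ℂ) : ‖φ (algebraMap ℂ A z)‖ = ‖z‖ := by
  rw [AlgHomClass.commutes, Algebra.algebraMap_self, RingHom.id_apply]

/-- Test `f` on the finite sequence of constants conjugate to the values of its coefficients at `t`.
Being constants, they have the same square sum `S` under every character, so `S ≤ ‖f‖ * √S`. -/
theorem sum_norm_character_apply_basis_sq_le (hev : IsNormingFamily ev)
    (f : HilbertDual A (L2 A)) (t : T) (s : Finset ℕ) :
    ∑ i ∈ s, ‖ev t (f.1 (L2.basis i))‖ ^ 2 ≤ ‖f‖ ^ 2 := by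
  set S := ∑ i ∈ s, ‖ev t (f.1 (L2.basis i))‖ ^ 2 with hS
  have hS0 : 0 ≤ S := Finset.sum_nonneg fun _ _ => sq_nonneg _
  let y : L2 A := L2.ofFinset s fun i => algebraMap ℂ A (star (ev t (f.1 (L2.basis i))))
  have hy : ‖y‖ ≤ √S := by
    refine Real.le_sqrt_of_sq_le ?_
    rw [L2.norm_ofFinset_sq]
    refine hev _ _ hS0 fun u => ?_
    rw [character_sum_star_mul_self, Complex.norm_real, Real.norm_of_nonneg
      (Finset.sum_nonneg fun _ _ => sq_nonneg _)]
    simp only [norm_character_algebraMap, norm_star]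
    exact hS.ge
  refine le_sq_of_le_mul_sqrt hS0 ?_
  have h1 : ev t (f.1 y) = (S : ℂ) := by
    rw [show y = _ from L2.ofFinset_eq_sum _ _, map_sum, map_sum, hS, Complex.ofReal_sum]
    exact Finset.sum_congr rfl fun i _ => by
      rw [map_smul, smul_eq_mul, character_algebraMap_star_mul]
  calc S = ‖ev t (f.1 y)‖ := by rw [h1, Complex.norm_real, Real.norm_of_nonneg hS0]
    _ ≤ ‖f.1 y‖ := norm_character_le _ _
    _ ≤ ‖f‖ * ‖y‖ := le_norm f y
    _ ≤ ‖f‖ * √S := mul_le_mul_of_nonneg_left hy (norm_nonneg _)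

theorem sum_smul_coord_apply_basis (s : Finset ℕ) (a : ℕ → A) (j : ℕ) :
    (∑ i ∈ s, a i • (coord i : HilbertDual A (L2 A))).1 (L2.basis j) =
      if j ∈ s then a j else 0 := by
  rw [sum_val]
  have : ∀ i, (a i • (coord i : HilbertDual A (L2 A))).1 (L2.basis j) =
      a i * if i = j then 1 else 0 := fun i => by
    rw [← L2.basis_apply]
    rfl
  simp only [this, mul_ite, mul_one, mul_zero, Finset.sum_ite_eq']

/-- The same duality test one level up, on combinations of coordinate functionals with constant
coefficients. -/
theorem sum_norm_character_apply_coord_sq_le (hev : IsNormingFamily ev)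
    (F : HilbertDual A (HilbertDual A (L2 A))) (t : T) (s : Finset ℕ) :
    ∑ i ∈ s, ‖ev t (F.1 (coord i))‖ ^ 2 ≤ ‖F‖ ^ 2 := by
  set S := ∑ i ∈ s, ‖ev t (F.1 (coord i))‖ ^ 2 with hS
  have hS0 : 0 ≤ S := Finset.sum_nonneg fun _ _ => sq_nonneg _
  let g : HilbertDual A (L2 A) :=
    ∑ i ∈ s, algebraMap ℂ A (star (ev t (F.1 (coord i)))) • coord i
  have hg : ‖g‖ ≤ √S := by
    refine norm_le_of_sum_sq_le hev (Real.sqrt_nonneg _) fun u r => ?_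
    rw [Real.sq_sqrt hS0]
    simp only [g, sum_smul_coord_apply_basis]
    have h2 : ∀ i, ‖ev u (if i ∈ s then algebraMap ℂ A (star (ev t (F.1 (coord i)))) else 0)‖ ^ 2
        = if i ∈ s then ‖ev t (F.1 (coord i))‖ ^ 2 else 0 := fun i => by
      split_ifs
      · rw [norm_character_algebraMap, norm_star]
      · simp
    simp only [h2]
    rw [← Finset.sum_filter, hS]
    exact Finset.sum_le_sum_of_subset_of_nonneg
      (fun i hi => (Finset.mem_filter.1 hi).2) fun _ _ _ => sq_nonneg _
  refine le_sq_of_le_mul_sqrt hS0 ?_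
  have h1 : ev t (F.1 g) = (S : ℂ) := by
    rw [map_sum, map_sum, hS, Complex.ofReal_sum]
    exact Finset.sum_congr rfl fun i _ => by
      rw [map_smul, smul_eq_mul, character_algebraMap_star_mul]
  calc S = ‖ev t (F.1 g)‖ := by rw [h1, Complex.norm_real, Real.norm_of_nonneg hS0]
    _ ≤ ‖F.1 g‖ := norm_character_le _ _
    _ ≤ ‖F‖ * ‖g‖ := le_norm F g
    _ ≤ ‖F‖ * √S := mul_le_mul_of_nonneg_left hg (norm_nonneg' _)

/-- The tails of `f` need not be small in norm. After multiplication by `d` only the character `t`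
sees them, so their norm is controlled by a tail of a convergent scalar series, while the value of
`F` at `t` is unchanged. -/
theorem hasSum_character_bidual (hev : IsNormingFamily ev) {t : T} {d : A} (hd : ev t d = 1)
    (hd' : ∀ u, u ≠ t → ev u d = 0) (F : HilbertDual A (HilbertDual A (L2 A)))
    (f : HilbertDual A (L2 A)) :
    HasSum (fun i => ev t (f.1 (L2.basis i)) * ev t (F.1 (coord i))) (ev t (F.1 f)) := by
  have hsum : Summable fun i => ‖ev t (f.1 (L2.basis i))‖ ^ 2 :=
    summable_of_sum_le (fun _ => sq_nonneg _) (sum_norm_character_apply_basis_sq_le hev f t)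
  rw [HasSum, SummationFilter.unconditional_filter, Metric.tendsto_atTop]
  intro ε hε
  set η := ε / (‖F‖ + 1) with hη
  have hη0 : 0 < η := div_pos hε (by linarith [norm_nonneg F])
  obtain ⟨s, hs⟩ := summable_iff_vanishing_norm.1 hsum (η ^ 2) (by positivity)
  refine ⟨s, fun r hr => ?_⟩
  let g : HilbertDual A (L2 A) := d • (f - ∑ i ∈ r, f.1 (L2.basis i) • coord i)
  have hgb : ∀ i, g.1 (L2.basis i) = if i ∈ r then 0 else d * f.1 (L2.basis i) := fun i => by
    have : g.1 (L2.basis i) = d * (f.1 (L2.basis i) -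
        (∑ i ∈ r, f.1 (L2.basis i) • (coord i : HilbertDual A (L2 A))).1 (L2.basis i)) := rfl
    rw [this, sum_smul_coord_apply_basis]
    split_ifs <;> simp
  have hg : ‖g‖ ≤ η := by
    refine norm_le_of_sum_sq_le hev hη0.le fun u q => ?_
    calc ∑ i ∈ q, ‖ev u (g.1 (L2.basis i))‖ ^ 2
        ≤ ∑ i ∈ q, if i ∈ r then 0 else ‖ev t (f.1 (L2.basis i))‖ ^ 2 := by
          refine Finset.sum_le_sum fun i _ => ?_
          rw [hgb]
          split_ifs
          · simp
          · by_cases hu : u = t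
            · rw [hu, map_mul, hd, one_mul]
            · rw [map_mul, hd' u hu, zero_mul, norm_zero, zero_pow two_ne_zero]
              exact sq_nonneg _
      _ = ∑ i ∈ q \ r, ‖ev t (f.1 (L2.basis i))‖ ^ 2 := by
          rw [Finset.sdiff_eq_filter, Finset.sum_filter]
          exact Finset.sum_congr rfl fun i _ => by split_ifs <;> rfl
      _ ≤ ‖∑ i ∈ q \ r, ‖ev t (f.1 (L2.basis i))‖ ^ 2‖ := le_abs_self _
      _ ≤ η ^ 2 := (hs _ (Finset.sdiff_disjoint.mono_right hr)).le
  have hF : ev t (F.1 g) = ev t (F.1 f) -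
      ∑ i ∈ r, ev t (f.1 (L2.basis i)) * ev t (F.1 (coord i)) := by
    simp only [g, map_smul, map_sub, map_sum, smul_eq_mul, map_mul, hd, one_mul]
  rw [dist_comm, dist_eq_norm, ← hF]
  calc ‖ev t (F.1 g)‖ ≤ ‖F.1 g‖ := norm_character_le _ _
    _ ≤ ‖F‖ * ‖g‖ := le_norm F g
    _ ≤ ‖F‖ * η := mul_le_mul_of_nonneg_left hg (norm_nonneg' _)
    _ < (‖F‖ + 1) * η := by linarith
    _ = ε := mul_div_cancel₀ _ (by linarith [norm_nonneg F])

end HilbertDual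

/-! ### A criterion for `C⋆`-reflexivity -/

section Reflexivity

variable {A : Type*} [CommCStarAlgebra A] {ev : ℕ → A →⋆ₐ[ℂ] ℂ}

theorem hilbertBidualMap_injective : Function.Injective (hilbertBidualMap A (L2 A)) := by
  intro x y h
  apply Subtype.ext
  funext i
  exact LinearMap.congr_fun (congrArg Subtype.val h) (HilbertDual.coord i)

/-- For the finitely many `n < N` the pointwise tails are small outside a common finite set. A block
avoiding it and still large in norm must have its mass detected at some `n ≥ N`. -/
theorem exists_large_disjoint {m : ℕ → A} (hev : IsNormingFamily ev)
    (hm : ∀ n, Summable fun i => ‖ev n (m i)‖ ^ 2) {ε : ℝ} (hε : 0 < ε)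
    (hlarge : ∀ s : Finset ℕ, ∃ t, Disjoint t s ∧ ε ≤ ‖∑ i ∈ t, star (m i) * m i‖)
    (s : Finset ℕ) (N : ℕ) :
    ∃ t : Finset ℕ, Disjoint t s ∧ ∃ n ≥ N, ε / 2 < ∑ i ∈ t, ‖ev n (m i)‖ ^ 2 := by
  choose r hr using fun n => summable_iff_vanishing_norm.1 (hm n) (ε / 2) (half_pos hε)
  obtain ⟨t, hts, ht⟩ := hlarge (s ∪ (Finset.range N).biUnion r)
  rw [Finset.disjoint_union_right] at hts
  refine ⟨t, hts.1, ?_⟩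
  by_contra! hcon
  have h : ‖∑ i ∈ t, star (m i) * m i‖ ≤ ε / 2 := by
    refine hev _ _ (half_pos hε).le fun n => ?_
    rw [character_sum_star_mul_self, Complex.norm_real]
    rcases lt_or_ge n N with hn | hn
    · exact (hr n t (hts.2.mono_right
        (Finset.subset_biUnion_of_mem r (Finset.mem_range.2 hn)))).le
    · rw [Real.norm_of_nonneg (Finset.sum_nonneg fun _ _ => sq_nonneg _)]
      exact hcon n hn
  linarith

/-- If the norm of `A` is determined by a sequence of characters with `|a (n + 1) - a n| → 0`
for all `a`, and `A` contains the indicator functions of points, then `A` is `C⋆`-reflexive. -/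
theorem isCStarReflexive_of_oscillation (hev : IsNormingFamily ev) {δ : ℕ → A}
    (hδ : ∀ n, ev n (δ n) = 1) (hδ' : ∀ m n, m ≠ n → ev m (δ n) = 0)
    (hosc : ∀ a, Tendsto (fun n => ‖ev (n + 1) a - ev n a‖) atTop (𝓝 0)) :
    IsCStarReflexive A := by
  refine ⟨hilbertBidualMap_injective, fun F => ?_⟩
  have hF : ∀ n f, HasSum (fun i => ev n (f.1 (L2.basis i)) * ev n (F.1 (HilbertDual.coord i)))
      (ev n (F.1 f)) := fun n f =>
    HilbertDual.hasSum_character_bidual hev (hδ n) (fun u hu => hδ' u n hu) F f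
  set m : ℕ → A := fun i => F.1 (HilbertDual.coord i) with hm
  have hbound : ∀ n s, ∑ i ∈ s, ‖ev n (m i)‖ ^ 2 ≤ ‖F‖ ^ 2 :=
    HilbertDual.sum_norm_character_apply_coord_sq_le hev F
  have hsum : Summable fun i => star (m i) * m i := by
    by_contra hns
    rw [summable_iff_vanishing_norm] at hns
    push Not at hns
    obtain ⟨ε, hε, hlarge⟩ := hns
    have key := exists_large_disjoint hev
      (fun n => summable_of_sum_le (fun _ => sq_nonneg _) (hbound n)) hε hlarge
    -- Each `p j` is a block with its point. The gap 2 keeps the successor of a chosen point from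
    -- being chosen.
    obtain ⟨p, hp, hpd⟩ := exists_seq_of_forall_finset_exists
      (fun p : Finset ℕ × ℕ => ε / 2 < ∑ i ∈ p.1, ‖ev p.2 (m i)‖ ^ 2)
      (fun p q => Disjoint q.1 p.1 ∧ p.2 + 2 ≤ q.2) fun S _ => by
        obtain ⟨t, ht, n, hn, h⟩ := key (S.biUnion Prod.fst) (S.sup fun p => p.2 + 2)
        exact ⟨(t, n), h, fun q hq => ⟨ht.mono_right (Finset.subset_biUnion_of_mem Prod.fst hq),
          (Finset.le_sup (f := fun p : Finset ℕ × ℕ => p.2 + 2) hq).trans hn⟩⟩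
    have hdisj : ∀ {i j k}, i ∈ (p j).1 → i ∈ (p k).1 → j = k := by
      intro i j k hj hk
      rcases lt_trichotomy j k with h | h | h
      · exact (Finset.disjoint_left.1 (hpd j k h).1 hk hj).elim
      · exact h
      · exact (Finset.disjoint_left.1 (hpd k j h).1 hj hk).elim
    have hsep : ∀ j k, j ≠ k → (p j).2 + 2 ≤ (p k).2 ∨ (p k).2 + 2 ≤ (p j).2 := fun j k hjk =>
      (lt_or_gt_of_ne hjk).imp (fun h => (hpd j k h).2) fun h => (hpd k j h).2
    have hmono : StrictMono fun j => (p j).2 := fun j k h => by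
      have := (hpd j k h).2
      simp only
      omega
    -- Disjointness of the blocks gives each `i` at most one point. Domination by `m i` is what
    -- makes the resulting functional bounded.
    have hc : ∀ i, ∃ c : A, ∀ n, ‖ev n c‖ ≤ ‖ev n (m i)‖ ∧ (∀ j, i ∈ (p j).1 → n = (p j).2 →
        ev n c = star (ev n (m i))) ∧ ((∀ j, i ∈ (p j).1 → n ≠ (p j).2) → ev n c = 0) := by
      intro i
      by_cases h : ∃ j, i ∈ (p j).1
      · obtain ⟨j, hj⟩ := h
        refine ⟨δ (p j).2 * star (m i), fun n => ?_⟩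
        by_cases hn : n = (p j).2
        · subst hn
          simp only [map_mul, hδ, one_mul, map_star, norm_star, le_refl, true_and, implies_true]
          exact fun h => (h j hj rfl).elim
        · simp only [map_mul, hδ' n _ hn, zero_mul, norm_zero, norm_nonneg, true_and,
            implies_true, and_true]
          intro k hk hnk
          exact (hn (hnk.trans (by rw [hdisj hk hj]))).elim
      · push Not at h
        exact ⟨0, fun n => ⟨by simp, fun j hj => (h j hj).elim, fun _ => map_zero _⟩⟩
    choose c hc using hc
    obtain ⟨f, hf⟩ := HilbertDual.exists_apply_basis_eq hev (HilbertDual.norm_nonneg' F)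
      (c := c) fun n s => (Finset.sum_le_sum fun i _ =>
        pow_le_pow_left₀ (norm_nonneg _) (hc i n).1 2).trans (hbound n s)
    have hpeak : ∀ j, ε / 2 ≤ ‖ev (p j).2 (F.1 f)‖ := by
      intro j
      have h1 : HasSum (fun i => ev (p j).2 (f.1 (L2.basis i)) * ev (p j).2 (m i))
          (∑ i ∈ (p j).1, ev (p j).2 (f.1 (L2.basis i)) * ev (p j).2 (m i)) := by
        refine hasSum_sum_of_ne_finset_zero fun i hi => ?_
        rw [hf, (hc i _).2.2, zero_mul]
        intro k hk hkj
        have hjk : j ≠ k := fun h => hi (h ▸ hk)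
        have := hsep j k hjk
        omega
      rw [(hF _ f).unique h1, Finset.sum_congr rfl fun i hi => by
        rw [hf, (hc i _).2.1 j hi rfl, RCLike.star_def, RCLike.conj_mul]]
      have h2 := hp j
      refine h2.le.trans (le_trans (le_of_eq ?_) (Complex.re_le_norm _))
      rw [Complex.re_sum]
      refine Finset.sum_congr rfl fun i _ => ?_
      norm_cast
    have hzero : ∀ j, ev ((p j).2 + 1) (F.1 f) = 0 := by
      intro j
      refine (hF _ f).unique (HasSum.congr_fun hasSum_zero fun i => ?_)
      rw [hf, (hc i _).2.2, zero_mul]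
      intro k _ hk
      rcases eq_or_ne j k with rfl | hjk
      · omega
      · have := hsep j k hjk
        omega
    have hlim := (hosc (F.1 f)).comp hmono.tendsto_atTop
    obtain ⟨j, hj⟩ := (hlim.eventually (gt_mem_nhds (half_pos hε))).exists
    have h1 := hpeak j
    simp only [Function.comp_apply, hzero, zero_sub, norm_neg] at hj
    linarith
  refine ⟨⟨m, hsum⟩, Subtype.ext (LinearMap.ext fun f => hev.ext fun n => ?_)⟩
  -- Under each evaluation both sides are the sum of the same scalar series.
  have h1 := (HilbertDual.hasSum_apply f ⟨m, hsum⟩).map (ev n)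
    (AddMonoidHomClass.continuous_of_bound (ev n) 1 fun a => by
      simpa using norm_character_le (ev n) a)
  refine HasSum.unique h1 ?_
  convert hF n f using 2 with i
  exact map_mul _ _ _

end Reflexivity

/-! ### The compactification `νℕ` -/

section Higson

/-- Evaluation at `n`, as a `⋆`-homomorphism. -/
noncomputable def higsonEval (n : ℕ) : higsonAlgebra →⋆ₐ[ℂ] ℂ where
  toFun a := a.1 n
  map_one' := rfl
  map_mul' _ _ := rfl
  map_zero' := rfl
  map_add' _ _ := rfl
  commutes' _ := rfl
  map_star' _ := rfl

theorem higsonEval_apply (n : ℕ) (a : higsonAlgebra) : higsonEval n a = a.1 n := rfl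

/-- A bounded sequence with `|a (n + 1) - a n| → 0`, as an element of the algebra. -/
noncomputable def higsonMk (a : ℕ → ℂ) (C : ℝ) (hC : ∀ n, ‖a n‖ ≤ C)
    (h : Tendsto (fun n => ‖a (n + 1) - a n‖) atTop (𝓝 0)) : higsonAlgebra :=
  ⟨BoundedContinuousFunction.ofNormedAddCommGroup a continuous_of_discreteTopology C hC, h⟩

theorem higsonMk_apply {a : ℕ → ℂ} {C : ℝ} (hC : ∀ n, ‖a n‖ ≤ C)
    (h : Tendsto (fun n => ‖a (n + 1) - a n‖) atTop (𝓝 0)) (n : ℕ) :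
    (higsonMk a C hC h).1 n = a n := rfl

/-- The indicator function of a point. -/
noncomputable def higsonSingle (n : ℕ) : higsonAlgebra :=
  higsonMk (Pi.single n 1) 1
    (fun m => by
      rcases eq_or_ne m n with rfl | h
      · simp
      · simp [h])
    (tendsto_const_nhds.congr' <| by
      filter_upwards [eventually_gt_atTop n] with m hm
      rw [Pi.single_eq_of_ne (by omega), Pi.single_eq_of_ne (by omega), sub_zero, norm_zero])

theorem higsonSingle_apply_self (n : ℕ) : (higsonSingle n).1 n = 1 :=
  Pi.single_eq_same (M := fun _ => ℂ) n 1

theorem higsonSingle_apply_of_ne {m n : ℕ} (h : m ≠ n) : (higsonSingle n).1 m = 0 :=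
  Pi.single_eq_of_ne (M := fun _ => ℂ) h 1

theorem isNormingFamily_higsonEval : IsNormingFamily higsonEval := fun a _ hC h =>
  (BoundedContinuousFunction.norm_le (f := a.1) hC).2 h

theorem isCStarReflexive_higsonAlgebra : IsCStarReflexive higsonAlgebra :=
  isCStarReflexive_of_oscillation isNormingFamily_higsonEval (δ := higsonSingle)
    higsonSingle_apply_self (fun _ _ h => higsonSingle_apply_of_ne h) fun a => a.2

/-- The Gelfand isomorphism `C(νℕ) ≃ A`. -/
noncomputable def higsonRestrict : C(HigsonCompactification, ℂ) ≃⋆ₐ[ℂ] higsonAlgebra :=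
  (gelfandStarTransform higsonAlgebra).symm

theorem higsonRestrict_apply (h : C(HigsonCompactification, ℂ)) (n : ℕ) :
    (higsonRestrict h).1 n = h (higsonUnit n) := by
  conv_rhs => rw [← (gelfandStarTransform higsonAlgebra).apply_symm_apply h]
  rfl

/-- The criterion is applied again with characters and indicators transported along the Gelfand
isomorphism, which avoids transporting modules and their duals. -/
theorem isCStarReflexive_continuousMap_higson :
    IsCStarReflexive C(HigsonCompactification, ℂ) := by
  refine isCStarReflexive_of_oscillation
    (ev := fun n => (higsonEval n).comp (higsonRestrict : _ →⋆ₐ[ℂ] _))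
    (δ := fun n => higsonRestrict.symm (higsonSingle n)) (fun a C hC h => ?_) (fun n => ?_)
    (fun m n h => ?_) fun a => (higsonRestrict a).2
  · rw [← StarAlgEquiv.norm_map higsonRestrict a]
    exact isNormingFamily_higsonEval _ C hC h
  · show (higsonRestrict (higsonRestrict.symm (higsonSingle n))).1 n = 1
    rw [StarAlgEquiv.apply_symm_apply, higsonSingle_apply_self]
  · show (higsonRestrict (higsonRestrict.symm (higsonSingle n))).1 m = 0
    rw [StarAlgEquiv.apply_symm_apply, higsonSingle_apply_of_ne h]

/-- A Urysohn function vanishing on the closure of the evaluations restricts to the zero sequence,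
hence is zero. -/
theorem denseRange_higsonUnit : DenseRange higsonUnit := by
  intro x
  by_contra hx
  obtain ⟨g, hg0, hg1, -⟩ := exists_continuous_zero_one_of_isClosed isClosed_closure
    isClosed_singleton (Set.disjoint_singleton_right.2 hx)
  let h : C(HigsonCompactification, ℂ) := (ContinuousMap.mk _ Complex.continuous_ofReal).comp g
  have h0 : higsonRestrict h = 0 := by
    refine isNormingFamily_higsonEval.ext fun n => ?_
    have : g (higsonUnit n) = 0 := hg0 (subset_closure ⟨n, rfl⟩)
    rw [higsonEval_apply, higsonRestrict_apply, map_zero]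
    simp [h, this]
  replace h0 : h = 0 := higsonRestrict.injective (h0.trans (map_zero higsonRestrict).symm)
  have h1 : g x = 1 := hg1 rfl
  have h2 := DFunLike.congr_fun h0 x
  simp [h, h1] at h2

theorem isOpenEmbedding_higsonUnit : IsOpenEmbedding higsonUnit := by
  have hval : ∀ m n, higsonUnit m (higsonSingle n) ≠ 0 ↔ m = n := by
    intro m n
    rw [higsonUnit_apply]
    rcases eq_or_ne m n with rfl | h
    · simp [higsonSingle_apply_self]
    · simp [higsonSingle_apply_of_ne h, h]
  have hopen : ∀ n, IsOpen {higsonUnit n} := by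
    intro n
    let U : Set HigsonCompactification := {χ | gelfandStarTransform _ (higsonSingle n) χ ≠ 0}
    have hU : IsOpen U := isOpen_ne_fun (ContinuousMap.continuous _) continuous_const
    have hUn : ∀ m, higsonUnit m ∈ U ↔ m = n := fun m => hval m n
    have : U = {higsonUnit n} := by
      -- Any other point of `U` would give a nonempty open set containing no evaluation, against
      -- density.
      refine Set.eq_singleton_iff_unique_mem.2 ⟨(hUn n).2 rfl, fun x hx => ?_⟩
      by_contra hne
      obtain ⟨m, hm⟩ := denseRange_higsonUnit.exists_mem_open
        (hU.sdiff (isClosed_singleton (x := higsonUnit n))) ⟨x, hx, hne⟩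
      exact hm.2 (by rw [(hUn m).1 hm.1]; rfl)
    rwa [← this]
  refine IsOpenEmbedding.of_continuous_injective_isOpenMap continuous_of_discreteTopology
    (fun m n h => ?_) fun s _ => ?_
  · rw [← hval, h, hval]
  · rw [← Set.biUnion_of_singleton s, Set.image_iUnion₂]
    exact isOpen_biUnion fun n _ => by rw [Set.image_singleton]; exact hopen n

end Higson

/-! ### Copies of `βℕ` in `νℕ` -/

section Interpolation

theorem exists_slowly_oscillating_extension {n : ℕ → ℕ} (hn : StrictMono n)
    (hgap : Tendsto (fun k => n (k + 1) - n k) atTop atTop) (b : ℕ → ℝ)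
    (hb : ∀ k, b k ∈ Set.Icc (0 : ℝ) 1) :
    ∃ a : higsonAlgebra, ∀ k, a.1 (n k) = (b k : ℂ) := by
  let w : ℕ → ℕ → ℝ := fun k m => ((m - n k : ℕ) : ℝ) / ((n (k + 1) - n k : ℕ) : ℝ)
  let L : ℕ → ℕ → ℝ := fun k m => b k + w k m * (b (k + 1) - b k)
  -- Index of the interval containing `m`; the search bound suffices because `k ≤ n k`. For `m < n
  -- 0` the default 0 and truncated subtraction in `w` give the constant value `b 0`.
  let κ : ℕ → ℕ := fun m => Nat.findGreatest (fun k => n k ≤ m) m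
  have hgap0 : ∀ k, 0 < n (k + 1) - n k := fun k => Nat.sub_pos_of_lt (hn k.lt_succ_self)
  have hκ : ∀ k m, n k ≤ m → m < n (k + 1) → κ m = k := by
    intro k m h1 h2
    refine Nat.findGreatest_eq_iff.2 ⟨hn.le_apply.trans h1, fun _ => h1, fun j hj _ h => ?_⟩
    exact absurd (h2.trans_le (hn.monotone hj)) h.not_gt
  have hκle : ∀ m, n 0 ≤ m → n (κ m) ≤ m := fun m h =>
    Nat.findGreatest_spec (P := fun k => n k ≤ m) (Nat.zero_le m) h
  have hκlt : ∀ m, m < n (κ m + 1) := by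
    intro m
    by_contra! h
    have h1 : κ m + 1 ≤ κ m := Nat.le_findGreatest (hn.le_apply.trans h) h
    omega
  have hκk : ∀ k, κ (n k) = k := fun k => hκ k (n k) le_rfl (hn k.lt_succ_self)
  have hκtop : Tendsto κ atTop atTop := by
    refine tendsto_atTop.2 fun k => ?_
    filter_upwards [eventually_ge_atTop (n k)] with m hm
    exact Nat.le_findGreatest (hn.le_apply.trans hm) hm
  have hL0 : ∀ k, L k (n k) = b k := fun k => by simp [L, w]
  have hL1 : ∀ k, L k (n (k + 1)) = b (k + 1) := fun k => by
    have h : ((n (k + 1) - n k : ℕ) : ℝ) ≠ 0 := Nat.cast_ne_zero.2 (hgap0 k).ne'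
    simp [L, w, div_self h]
  -- Neighbouring linear pieces agree at the shared endpoint, so a step from `m` to `m + 1` can
  -- always be computed on one piece.
  have hL : ∀ k m, n k ≤ m → m ≤ n (k + 1) → L (κ m) m = L k m := by
    intro k m h1 h2
    rcases h2.eq_or_lt with rfl | h2
    · rw [hκk, hL0, hL1]
    · rw [hκ k m h1 h2]
  have hw : ∀ m, w (κ m) m ∈ Set.Icc (0 : ℝ) 1 := by
    intro m
    refine ⟨by positivity, div_le_one_of_le₀ ?_ (Nat.cast_nonneg _)⟩
    have := hκlt m
    exact_mod_cast Nat.sub_le_sub_right this.le _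
  have hbound : ∀ m, ‖((L (κ m) m : ℝ) : ℂ)‖ ≤ 1 := by
    intro m
    obtain ⟨h1, h2⟩ := hw m
    obtain ⟨h3, h4⟩ := hb (κ m)
    obtain ⟨h5, h6⟩ := hb (κ m + 1)
    have e : L (κ m) m = (1 - w (κ m) m) * b (κ m) + w (κ m) m * b (κ m + 1) := by
      simp only [L]
      ring
    have h7 : 0 ≤ 1 - w (κ m) m := by linarith
    rw [Complex.norm_real, Real.norm_of_nonneg (by rw [e]; positivity), e]
    calc _ ≤ (1 - w (κ m) m) * 1 + w (κ m) m * 1 := by gcongr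
      _ = 1 := by ring
  have hstep : ∀ m, n 0 ≤ m → ‖((L (κ (m + 1)) (m + 1) : ℝ) : ℂ) - ((L (κ m) m : ℝ) : ℂ)‖ ≤
      (((n (κ m + 1) - n (κ m) : ℕ) : ℝ))⁻¹ := by
    intro m hm
    have h1 := hκle m hm
    rw [hL (κ m) (m + 1) (h1.trans m.le_succ) (hκlt m)]
    have h2 : ((m + 1 - n (κ m) : ℕ) : ℝ) = ((m - n (κ m) : ℕ) : ℝ) + 1 := by
      rw [Nat.sub_add_comm h1]
      push_cast
      ring
    have e : L (κ m) (m + 1) - L (κ m) m =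
        (((n (κ m + 1) - n (κ m) : ℕ) : ℝ))⁻¹ * (b (κ m + 1) - b (κ m)) := by
      simp only [L, w, h2]
      ring
    obtain ⟨h3, h4⟩ := hb (κ m)
    obtain ⟨h5, h6⟩ := hb (κ m + 1)
    rw [← Complex.ofReal_sub, Complex.norm_real, e, norm_mul,
      Real.norm_of_nonneg (by positivity)]
    refine mul_le_of_le_one_right (by positivity) ?_
    rw [Real.norm_eq_abs, abs_le]
    constructor <;> linarith
  have hosc : Tendsto (fun m => ‖((L (κ (m + 1)) (m + 1) : ℝ) : ℂ) - ((L (κ m) m : ℝ) : ℂ)‖)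
      atTop (𝓝 0) := by
    refine squeeze_zero' (Eventually.of_forall fun _ => norm_nonneg _)
      ((eventually_ge_atTop (n 0)).mono hstep) ?_
    exact tendsto_inv_atTop_zero.comp
      (tendsto_natCast_atTop_atTop.comp (hgap.comp hκtop))
  refine ⟨higsonMk (fun m => ((L (κ m) m : ℝ) : ℂ)) 1 hbound hosc, fun k => ?_⟩
  rw [higsonMk_apply, hκk, hL0]

/-- By compactness only injectivity is at stake. A Urysohn function separating `p` and `q` in `βℕ`
is, by interpolation and density of `ℕ`, the pullback of some element of the algebra, so the images
of `p` and `q` differ. -/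
theorem exists_isClosedEmbedding_stoneCech {n : ℕ → ℕ} (hn : StrictMono n)
    (hgap : Tendsto (fun k => n (k + 1) - n k) atTop atTop) :
    ∃ j : StoneCech ℕ → HigsonCompactification,
      IsClosedEmbedding j ∧ ∀ k, j (stoneCechUnit k) = higsonUnit (n k) := by
  have hcont : Continuous fun k => higsonUnit (n k) := continuous_of_discreteTopology
  have hj := continuous_stoneCechExtend hcont
  refine ⟨stoneCechExtend hcont, hj.isClosedEmbedding fun p q hpq => ?_,
    fun k => stoneCechExtend_stoneCechUnit hcont k⟩
  by_contra hne
  obtain ⟨g, hg0, hg1, hg⟩ := exists_continuous_zero_one_of_isClosed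
    (isClosed_singleton (x := p)) (isClosed_singleton (x := q))
    (Set.disjoint_singleton.2 hne)
  obtain ⟨a, ha⟩ := exists_slowly_oscillating_extension hn hgap
    (fun k => g (stoneCechUnit k)) fun k => hg _
  have key : (fun x => gelfandStarTransform higsonAlgebra a (stoneCechExtend hcont x)) =
      fun x => ((g x : ℝ) : ℂ) := by
    refine stoneCech_hom_ext ((ContinuousMap.continuous _).comp hj)
      (Complex.continuous_ofReal.comp g.continuous) (funext fun k => ?_)
    simp only [Function.comp_apply, stoneCechExtend_stoneCechUnit]
    exact ha k
  have h1 := (congrFun key p).symm.trans ((congrArg _ hpq).trans (congrFun key q))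
  have hp : g p = 0 := hg0 rfl
  have hq : g q = 1 := hg1 rfl
  simp [hp, hq] at h1

theorem exists_strictMono_gaps_tendsto_atTop :
    ∃ n : ℕ → ℕ, StrictMono n ∧ Tendsto (fun k => n (k + 1) - n k) atTop atTop := by
  refine ⟨fun k => k ^ 2, Nat.pow_left_strictMono two_ne_zero, ?_⟩
  refine tendsto_atTop_mono (fun k => ?_) tendsto_id
  have : (k + 1) ^ 2 = k ^ 2 + (2 * k + 1) := by ring
  simp only [id]
  omega

end Interpolation

theorem mainTheorem4 :
    -- `νℕ` is a compactification of the discrete space `ℕ`, and restriction to `ℕ` identifies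
    -- `C(νℕ)` with the algebra `A`
    (IsOpenEmbedding higsonUnit ∧ DenseRange higsonUnit ∧
      ∃ Φ : C(HigsonCompactification, ℂ) ≃⋆ₐ[ℂ] higsonAlgebra,
        ∀ h n, (Φ h).1 n = h (higsonUnit n)) ∧
    -- `A = C(νℕ)` is `C⋆`-reflexive
    IsCStarReflexive higsonAlgebra ∧
    IsCStarReflexive C(HigsonCompactification, ℂ) ∧
    -- `βℕ` embeds in `νℕ`, by extension of `k ↦ n k` for every increasing sequence of integers
    -- whose gaps tend to infinity
    (∀ n : ℕ → ℕ, StrictMono n → Tendsto (fun k => n (k + 1) - n k) atTop atTop →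
      ∃ j : StoneCech ℕ → HigsonCompactification,
        IsClosedEmbedding j ∧ ∀ k, j (stoneCechUnit k) = higsonUnit (n k)) ∧
    (∃ j : StoneCech ℕ → HigsonCompactification, IsClosedEmbedding j) ∧
    -- not containing a closed copy of `βℕ` is therefore not necessary for reflexivity of `C(X)`
    ¬ (∀ (X : Type) [TopologicalSpace X] [CompactSpace X] [T2Space X],
        IsCStarReflexive C(X, ℂ) → ¬ ∃ j : StoneCech ℕ → X, IsClosedEmbedding j) := by
  obtain ⟨n, hn, hgap⟩ := exists_strictMono_gaps_tendsto_atTop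
  obtain ⟨j, hj, -⟩ := exists_isClosedEmbedding_stoneCech hn hgap
  exact ⟨⟨isOpenEmbedding_higsonUnit, denseRange_higsonUnit, higsonRestrict,
      higsonRestrict_apply⟩, isCStarReflexive_higsonAlgebra,
    isCStarReflexive_continuousMap_higson,
    fun _ hn hgap => exists_isClosedEmbedding_stoneCech hn hgap, ⟨j, hj⟩,
    fun h => h _ isCStarReflexive_continuousMap_higson ⟨j, hj⟩⟩
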